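/- Let $X$ be a real locally convex topological vector space with topological dual $X^*$. A convex polyhedron in $X$ is a set of the form $\{x\in X \mid \langle x_i^*,x\rangle\le\alpha_i,\ i=1,\dots,k\}$ with $k\in\{0,1,2,\dots\}$, $x_i^*\in X^*$ and $\alpha_i\in\mathbb R$. For a convex set $\Omega\subset X$ the quasi-relative interior is $$\operatorname{qri}(\Omega)=\{x\in\Omega \mid \overline{\operatorname{cone}(\Omega-x)}\ \text{is a linear subspace of } X\},\qquad \operatorname{cone}(A)=\{ta \mid t\ge 0,\ a\in A\}.$$ For a nonempty set $A\subset X$ the support function is $\sigma_A(x^*)=\sup\{\langle x^*,x\rangle \mid x\in A\}\in(-\infty,\infty]$, $x^*\in X^*$, with domain $\operatorname{dom}\sigma_A=\{x^*\in X^* \mid \sigma_A(x^*)<\infty\}$. For functions $f,g\colon X^*\to(-\infty,\infty]$ the infimal convolution is $(f\,\square\, g)(x^*)=\inf\{f(x_1^*)+g(x_2^*) \mid x_1^*+x_2^*=x^*\}$. **Theorem.** Let $P\subset X$ be a nonempty convex polyhedron and let $\Omega\subset X$ be a nonempty convex set such that $P\cap\operatorname{qri}(\Omega)\ne\emptyset$.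 Then $$\sigma_{P\cap\Omega}(x^*)=(\sigma_P\,\square\,\sigma_\Omega)(x^*)\quad\text{for all } x^*\in X^*.$$ Moreover, for every $x^*\in\operatorname{dom}\sigma_{P\cap\Omega}$ there exist $x_1^*,x_2^*\in X^*$ with $x^*=x_1^*+x_2^*$ and $$\sigma_{P\cap\Omega}(x^*)=\sigma_P(x_1^*)+\sigma_\Omega(x_2^*).$$ -/

import Mathlib

noncomputable section

open scoped Pointwise

/-- The conic hull `{t • a | t ≥ 0, a ∈ A}` of a set. -/
def conicHull {X : Type*} [AddCommGroup X] [Module ℝ X] (A : Set X) : Set X :=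
  {y | ∃ t : ℝ, 0 ≤ t ∧ ∃ a ∈ A, y = t • a}

/-- The quasi-relative interior of `Ω`: the points `x ∈ Ω` such that the closure of
`cone (Ω - x)` is a linear subspace. -/
def qri {X : Type*} [AddCommGroup X] [Module ℝ X] [TopologicalSpace X] (Ω : Set X) : Set X :=
  {x | x ∈ Ω ∧ ∃ S : Submodule ℝ X, (S : Set X) = closure (conicHull (Ω - {x}))}

/-- A convex polyhedron: the solution set of finitely many (possibly zero) inequalities
`⟨x_i^*, x⟩ ≤ α_i` with continuous linear functionals `x_i^*`. -/
def IsConvexPolyhedron {X : Type*} [AddCommGroup X] [Module ℝ X] [TopologicalSpace X]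
    (P : Set X) : Prop :=
  ∃ (k : ℕ) (f : Fin k → StrongDual ℝ X) (α : Fin k → ℝ), P = {x | ∀ i, f i x ≤ α i}

/-- The support function `σ_Ω(x^*) = sup {⟨x^*, x⟩ | x ∈ Ω}`, with extended real values. -/
def supportFunction {X : Type*} [AddCommGroup X] [Module ℝ X] [TopologicalSpace X]
    (Ω : Set X) (xs : StrongDual ℝ X) : EReal :=
  ⨆ x ∈ Ω, ((xs x : ℝ) : EReal)

/-- The infimal convolution `(f □ g)(x) = inf {f(x₁) + g(x₂) | x₁ + x₂ = x}` of two functions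
that do not take the value `-∞`. (The sum `-∞ + ∞` never occurs for such functions.) -/
def infimalConvolution {Y : Type*} [Add Y] (f g : Y → EReal) (x : Y) : EReal :=
  ⨅ (x₁ : Y) (x₂ : Y) (_ : x₁ + x₂ = x), f x₁ + g x₂

/-- The (effective) domain `{x | f x < ∞}` of an extended-real-valued function. -/
def effectiveDomain {Y : Type*} (f : Y → EReal) : Set Y := {x | f x < ⊤}

end

/-!
Fix `x^*` with `σ_{P ∩ Ω}(x^*) = β < ∞`, and let `P = {f i ≤ α i}`. It suffices to find Lagrange
multipliers `c i ≥ 0` with `x^* - β ≤ ∑ i, c i • (f i - α i)` on all of `Ω`: then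
`x₁ = ∑ i, c i • f i` and `x₂ = x^* - x₁` satisfy `σ_P(x₁) + σ_Ω(x₂) ≤ β`, and the reverse
inequality holds for every decomposition of `x^*`.

The only consequence of `x₀ ∈ qri Ω` that is needed is that no continuous affine function which
vanishes at `x₀` supports `Ω` at `x₀` unless it vanishes on all of `Ω` (`IsNonsupportPoint`). This
property, unlike the constraint qualification of Slater, is stable under intersecting `Ω` with a
hyperplane through `x₀` (`IsNonsupportPoint.inter_zero`), because for a single equality constraint
multipliers can be found by comparing difference quotients
(`IsNonsupportPoint.exists_multiplier_eq`).

For several inequality constraints (`IsNonsupportPoint.exists_multipliers`), separation in a finite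
dimensional space gives multipliers of Fritz John type. If the multiplier of the objective vanishes,
then a nontrivial nonnegative combination of the constraints vanishes on `Ω`, so that some
constraint `g j` is, on `Ω`, a nonpositive combination of the others. The feasible points
then lie in `{g j = 0}`, and induction applies to `Ω ∩ {g j = 0}` with the other constraints. The
multiplier of the equality `g j = 0` may come out negative, but the linear dependence turns it
into nonnegative multipliers of the other constraints.
-/

/-! ### Points that admit only trivial supporting functions -/

section Multipliers

variable {X : Type*} [AddCommGroup X] [Module ℝ X] [TopologicalSpace X]

/-- `x₀` is a point of `Ω` at which every supporting continuous affine function is trivial: if it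
vanishes at `x₀` and is nonpositive on `Ω`, then it vanishes on `Ω`. Affine functions are used in
place of linear ones so that constraints with a constant term need no translation. -/
def IsNonsupportPoint (Ω : Set X) (x₀ : X) : Prop :=
  x₀ ∈ Ω ∧ ∀ g : X →ᴬ[ℝ] ℝ, g x₀ = 0 → (∀ x ∈ Ω, g x ≤ 0) → ∀ x ∈ Ω, g x = 0

theorem ContinuousAffineMap.real_combo_apply (g : X →ᴬ[ℝ] ℝ) {a b : ℝ} (h : a + b = 1) (x y : X) :
    g (a • x + b • y) = a * g x + b * g y :=
  Convex.combo_affine_apply (f := (g : X →ᵃ[ℝ] ℝ)) h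

theorem ContinuousAffineMap.sum_smul_apply {ι : Type*} (s : Finset ι) (c : ι → ℝ)
    (g : ι → X →ᴬ[ℝ] ℝ) (x : X) : (∑ i ∈ s, c i • g i) x = ∑ i ∈ s, c i * g i x := by
  classical
  induction s using Finset.induction_on with
  | empty => simp
  | insert j t hj ih => simp [Finset.sum_insert hj, ih]

open scoped Pointwise in
theorem isNonsupportPoint_of_mem_qri [IsTopologicalAddGroup X] {Ω : Set X} {x₀ : X}
    (h : x₀ ∈ qri Ω) : IsNonsupportPoint Ω x₀ := by
  obtain ⟨hx₀, S, hS⟩ := h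
  refine ⟨hx₀, fun g hg₀ hg x hx => le_antisymm (hg x hx) ?_⟩
  have key : ∀ y, g (y + x₀) = g.contLinear y := fun y => by
    have := g.map_vadd x₀ y
    simpa [hg₀] using this
  have hcont : Continuous fun y => g.contLinear y := g.contLinear.continuous
  have hle : ∀ y ∈ S, g.contLinear y ≤ 0 := by
    have hsub : closure (conicHull (Ω - {x₀})) ⊆ {y | g.contLinear y ≤ 0} := by
      refine closure_minimal ?_ (isClosed_le hcont continuous_const)
      rintro y ⟨t, ht, a, ⟨z, hz, w, hw, rfl⟩, rfl⟩
      obtain rfl : w = x₀ := hw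
      have h1 := key (z - w)
      have h2 := hg z hz
      simp only [sub_add_cancel] at h1
      simp only [Set.mem_ofPred_eq, map_smul, smul_eq_mul]
      exact mul_nonpos_of_nonneg_of_nonpos ht (h1 ▸ h2)
    intro y hy
    exact hsub (hS ▸ hy)
  have hmem : x - x₀ ∈ S := by
    rw [← SetLike.mem_coe, hS]
    exact subset_closure ⟨1, zero_le_one, x - x₀, ⟨x, hx, x₀, rfl, rfl⟩, (one_smul _ _).symm⟩
  have h1 := hle _ (S.neg_mem hmem)
  have h2 := key (x - x₀)
  rw [map_neg] at h1
  rw [sub_add_cancel] at h2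
  linarith

/-! ### Lagrange multipliers -/

/-- Lagrange multiplier for one affine equality constraint. It is any number between the
quotients `φ p / h p` with `h p > 0` and those with `h p < 0`. -/
theorem IsNonsupportPoint.exists_multiplier_eq {Ω : Set X} {x₀ : X} (hx₀ : IsNonsupportPoint Ω x₀)
    (hΩ : Convex ℝ Ω) (h φ : X →ᴬ[ℝ] ℝ) (h₀ : h x₀ = 0)
    (hφ : ∀ x ∈ Ω, h x = 0 → φ x ≤ 0) : ∃ c : ℝ, ∀ x ∈ Ω, φ x ≤ c * h x := by
  by_cases hz : ∀ x ∈ Ω, h x = 0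
  · exact ⟨0, fun x hx => by simpa using hφ x hx (hz x hx)⟩
  have hpos : ∃ p ∈ Ω, 0 < h p := by
    by_contra! hc
    exact hz (hx₀.2 h h₀ hc)
  have hneg : ∃ q ∈ Ω, h q < 0 := by
    by_contra! hc
    refine hz fun x hx => ?_
    have := hx₀.2 (-h) (by simp [h₀]) (fun x hx => by simpa using hc x hx) x hx
    simpa using this
  obtain ⟨p, hp, hp'⟩ := hpos
  obtain ⟨q, hq, hq'⟩ := hneg
  obtain ⟨c, hc₁, hc₂⟩ := exists_between_of_forall_le
    (s := {r | ∃ p ∈ Ω, 0 < h p ∧ r = φ p / h p}) (t := {r | ∃ q ∈ Ω, h q < 0 ∧ r = φ q / h q})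
    ⟨_, p, hp, hp', rfl⟩ ⟨_, q, hq, hq', rfl⟩ (by
      rintro _ ⟨p, hp, hp', rfl⟩ _ ⟨q, hq, hq', rfl⟩
      have hd : 0 < h p - h q := by linarith
      -- The convex combination of `p` and `q` on the hyperplane `h = 0`.
      have hab : -h q / (h p - h q) + h p / (h p - h q) = 1 := by
        field_simp
        ring
      have hmem := hΩ hp hq (div_nonneg (by linarith : 0 ≤ -h q) hd.le)
        (div_nonneg hp'.le hd.le) hab
      have h1 := hφ _ hmem (by rw [h.real_combo_apply hab]; ring)
      rw [φ.real_combo_apply hab] at h1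
      have h2 : -h q * φ p + h p * φ q ≤ 0 := by
        have h3 : (-h q * φ p + h p * φ q) / (h p - h q) ≤ 0 := by
          refine le_trans (le_of_eq ?_) h1
          ring
        by_contra! hcon
        exact absurd (div_pos hcon hd) (not_lt.mpr h3)
      rw [← neg_div_neg_eq (φ q), div_le_div_iff₀ hp' (by linarith)]
      linarith)
  refine ⟨c, fun x hx => ?_⟩
  rcases lt_trichotomy (h x) 0 with hlt | heq | hgt
  · have := hc₂ ⟨x, hx, hlt, rfl⟩
    exact (le_div_iff_of_neg hlt).1 this
  · rw [heq, mul_zero]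
    exact hφ x hx heq
  · have := hc₁ ⟨x, hx, hgt, rfl⟩
    exact (div_le_iff₀ hgt).1 this

theorem IsNonsupportPoint.inter_zero {Ω : Set X} {x₀ : X} (hx₀ : IsNonsupportPoint Ω x₀)
    (hΩ : Convex ℝ Ω) (h : X →ᴬ[ℝ] ℝ) (h₀ : h x₀ = 0) :
    IsNonsupportPoint (Ω ∩ {x | h x = 0}) x₀ := by
  refine ⟨⟨hx₀.1, h₀⟩, fun g hg₀ hg x hx => ?_⟩
  obtain ⟨c, hc⟩ := hx₀.exists_multiplier_eq hΩ h g h₀ fun x hx hx' => hg x ⟨hx, hx'⟩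
  have := hx₀.2 (g - c • h) (by simp [hg₀, h₀])
    (fun x hx => by simpa using hc x hx) x hx.1
  have hx0 : h x = 0 := hx.2
  simpa [hx0] using this

/-- Gordan's alternative for affine functions on a convex set. -/
theorem exists_nonneg_combination_nonneg {ι : Type*} [Fintype ι] {Ω : Set X} (hΩ : Convex ℝ Ω)
    (hne : Ω.Nonempty) (h : ι → X →ᴬ[ℝ] ℝ) (hh : ∀ x ∈ Ω, ∃ i, 0 ≤ h i x) :
    ∃ c : ι → ℝ, (∀ i, 0 ≤ c i) ∧ c ≠ 0 ∧ ∀ x ∈ Ω, 0 ≤ ∑ i, c i * h i x := by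
  classical
  let B : Set (ι → ℝ) := {u | ∀ i, u i < 0}
  let A : Set (ι → ℝ) := (fun x i => h i x) '' Ω
  have hBo : IsOpen B := by
    have : B = ⋂ i, {u : ι → ℝ | u i < 0} := by ext; simp [B]
    rw [this]
    exact isOpen_iInter_of_finite fun i => isOpen_lt (continuous_apply i) continuous_const
  have hBc : Convex ℝ B := by
    have : B = ⋂ i, {u : ι → ℝ | u i < 0} := by ext; simp [B]
    rw [this]
    exact convex_iInter fun i =>
      convex_halfSpace_lt (LinearMap.proj i : (ι → ℝ) →ₗ[ℝ] ℝ).isLinear 0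
  have hAc : Convex ℝ A := by
    rintro _ ⟨x, hx, rfl⟩ _ ⟨y, hy, rfl⟩ a b ha hb hab
    refine ⟨a • x + b • y, hΩ hx hy ha hb hab, ?_⟩
    funext i
    simpa using (h i).real_combo_apply hab x y
  have hdisj : Disjoint B A := by
    rw [Set.disjoint_left]
    rintro _ hu ⟨x, hx, rfl⟩
    obtain ⟨i, hi⟩ := hh x hx
    exact absurd (hu i) (not_lt.mpr hi)
  obtain ⟨F, r, hF₁, hF₂⟩ := geometric_hahn_banach_open hBc hBo hAc hdisj
  have hrep : ∀ u, F u = ∑ i, F (Pi.single i 1) * u i := fun u => by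
    conv_lhs => rw [pi_eq_sum_univ' u]
    simp [mul_comm]
  -- Points of `B` tending to a point of its closure show that `F ≤ r` on the closure.
  have hcl : ∀ u : ι → ℝ, (∀ i, u i ≤ 0) → F u ≤ r := fun u hu => by
    have hlim : Filter.Tendsto (fun ε : ℝ => F (u - ε • 1)) (nhdsWithin 0 (Set.Ioi 0))
        (nhds (F u)) := by
      have hc : Continuous fun ε : ℝ => F (u - ε • 1) := by fun_prop
      have := hc.tendsto 0
      simp only [zero_smul, sub_zero] at this
      exact this.mono_left nhdsWithin_le_nhds
    refine le_of_tendsto hlim ?_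
    filter_upwards [self_mem_nhdsWithin] with ε hε
    refine (hF₁ _ fun i => ?_).le
    have : 0 < ε := hε
    simp
    linarith [hu i]
  have hr : 0 ≤ r := by simpa using hcl 0 fun _ => le_rfl
  refine ⟨fun i => F (Pi.single i 1), fun i => ?_, fun hzero => ?_, ?_⟩
  · -- `F` is bounded above by `r` on a ray in direction `-e i`, so it is nonnegative at `e i`.
    by_contra! hc
    have h1 := hcl ((-(r + 1) / -F (Pi.single i 1)) • Pi.single i 1) fun j => by
      rw [Pi.smul_apply, smul_eq_mul]
      refine mul_nonpos_of_nonpos_of_nonneg ?_ ?_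
      · exact div_nonpos_of_nonpos_of_nonneg (by linarith) (by linarith)
      · by_cases hij : j = i
        · subst hij; simp
        · simp [hij]
    rw [map_smul, smul_eq_mul, neg_div_neg_eq, div_mul_cancel₀ _ hc.ne] at h1
    linarith
  · obtain ⟨x, hx⟩ := hne
    have h1 := hF₁ (fun _ => -1) fun _ => by norm_num
    have h2 := hF₂ _ ⟨x, hx, rfl⟩
    rw [hrep] at h1 h2
    have h3 : ∀ i, F (Pi.single i 1) = 0 := fun i => congrFun hzero i
    simp only [h3, zero_mul, Finset.sum_const_zero] at h1 h2
    linarith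
  · intro x hx
    have h1 := hF₂ _ ⟨x, hx, rfl⟩
    rw [hrep] at h1
    linarith

/-- Lagrange multipliers for finitely many affine inequality constraints. No strict feasibility
of `x₀` is required. -/
theorem IsNonsupportPoint.exists_multipliers {ι : Type*} (s : Finset ι) (g : ι → X →ᴬ[ℝ] ℝ)
    (φ : X →ᴬ[ℝ] ℝ) {x₀ : X} {Ω : Set X} (hx₀ : IsNonsupportPoint Ω x₀) (hΩ : Convex ℝ Ω)
    (hg : ∀ i ∈ s, g i x₀ ≤ 0) (hφ : ∀ x ∈ Ω, (∀ i ∈ s, g i x ≤ 0) → φ x ≤ 0) :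
    ∃ c : ι → ℝ, (∀ i, 0 ≤ c i) ∧ ∀ x ∈ Ω, φ x ≤ ∑ i ∈ s, c i * g i x := by
  classical
  induction s using Finset.strongInduction generalizing Ω with
  | H s ih =>
  obtain ⟨c, hc, hc_ne, hsum⟩ := exists_nonneg_combination_nonneg hΩ ⟨x₀, hx₀.1⟩
    (fun o : Option s => o.elim (-φ) fun i => g i) (by
      intro x hx
      by_contra! hcon
      have h1 := hcon none
      have h2 := hφ x hx fun i hi => (hcon (some ⟨i, hi⟩)).le
      simp at h1
      linarith)
  -- The multipliers of the constraints, extended by zero outside `s`.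
  let d : ι → ℝ := fun i => if hi : i ∈ s then c (some ⟨i, hi⟩) else 0
  have hd : ∀ i, 0 ≤ d i := fun i => by
    by_cases hi : i ∈ s <;> simp [d, hi, hc]
  have hsum' : ∀ x ∈ Ω, c none * φ x ≤ ∑ i ∈ s, d i * g i x := fun x hx => by
    have h1 := hsum x hx
    rw [Fintype.sum_option] at h1
    have h2 : ∑ i ∈ s, d i * g i x = ∑ i : s, c (some i) * g i x := by
      rw [← Finset.sum_coe_sort s]
      exact Finset.sum_congr rfl fun i _ => by simp [d]
    simp only [Option.elim, ContinuousAffineMap.neg_apply] at h1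
    rw [h2]
    linarith
  rcases (hc none).lt_or_eq with hpos | hzero
  · refine ⟨fun i => d i / c none, fun i => div_nonneg (hd i) hpos.le, fun x hx => ?_⟩
    have h1 : φ x ≤ (∑ i ∈ s, d i * g i x) / c none := by
      rw [le_div_iff₀ hpos, mul_comm]
      exact hsum' x hx
    refine h1.trans (le_of_eq ?_)
    rw [Finset.sum_div]
    exact Finset.sum_congr rfl fun i _ => by ring
  · have hnn : ∀ x ∈ Ω, 0 ≤ ∑ i ∈ s, d i * g i x := fun x hx => by
      simpa [← hzero] using hsum' x hx
    have hterm : ∀ i ∈ s, d i * g i x₀ ≤ 0 := fun i hi =>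
      mul_nonpos_of_nonneg_of_nonpos (hd i) (hg i hi)
    have hsum₀ : ∑ i ∈ s, d i * g i x₀ = 0 :=
      le_antisymm (Finset.sum_nonpos hterm) (hnn x₀ hx₀.1)
    have hvanish : ∀ x ∈ Ω, ∑ i ∈ s, d i * g i x = 0 := fun x hx => by
      have := hx₀.2 (-∑ i ∈ s, d i • g i)
        (by simp [ContinuousAffineMap.sum_smul_apply, hsum₀])
        (fun x hx => by simpa [ContinuousAffineMap.sum_smul_apply] using hnn x hx) x hx
      simpa [ContinuousAffineMap.sum_smul_apply] using this
    obtain ⟨j, hj, hdj⟩ : ∃ j ∈ s, 0 < d j := by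
      by_contra! hcon
      refine hc_ne (funext fun o => ?_)
      cases o with
      | none => exact hzero.symm
      | some i =>
        have h1 := hcon i i.2
        simp only [d, i.2, dite_true] at h1
        exact le_antisymm h1 (hc _)
    have hj₀ : g j x₀ = 0 := by
      have := (Finset.sum_eq_zero_iff_of_nonpos hterm).1 hsum₀ j hj
      exact (mul_eq_zero.1 this).resolve_left hdj.ne'
    have hconv : Convex ℝ (Ω ∩ {x | g j x = 0}) := by
      rintro x ⟨hx, hx'⟩ y ⟨hy, hy'⟩ a b ha hb hab
      refine ⟨hΩ hx hy ha hb hab, ?_⟩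
      simp only [Set.mem_ofPred_eq] at hx' hy' ⊢
      rw [(g j).real_combo_apply hab, hx', hy']
      ring
    obtain ⟨e, he, hφe⟩ := ih (s.erase j) (Finset.erase_ssubset hj)
      (hx₀.inter_zero hΩ (g j) hj₀) hconv
      (fun i hi => hg i (Finset.mem_of_mem_erase hi))
      (fun x hx hx' => hφ x hx.1 fun i hi => by
        by_cases hij : i = j
        · subst hij; exact le_of_eq hx.2
        · exact hx' i (Finset.mem_erase.2 ⟨hij, hi⟩))
    obtain ⟨ν, hν⟩ := hx₀.exists_multiplier_eq hΩ (g j) (φ - ∑ i ∈ s.erase j, e i • g i) hj₀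
      (fun x hx hx' => by
        simpa [ContinuousAffineMap.sum_smul_apply] using hφe x ⟨hx, hx'⟩)
    -- Adding the multiple `τ` of the relation `∑ d i * g i = 0` makes the coefficient
    -- `ν + τ * d j` of `g j` nonnegative.
    let τ := |ν| / d j
    have hτ : 0 ≤ τ := div_nonneg (abs_nonneg ν) hdj.le
    have hτj : τ * d j = |ν| := div_mul_cancel₀ _ hdj.ne'
    refine ⟨fun i => if i = j then ν + τ * d j else e i + τ * d i, fun i => ?_, fun x hx => ?_⟩
    · by_cases hij : i = j
      · simp only [hij, if_true, hτj]
        linarith [neg_abs_le ν]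
      · simp only [hij, if_false]
        exact add_nonneg (he i) (mul_nonneg hτ (hd i))
    · have h1 := hν x hx
      have h2 := hvanish x hx
      rw [← Finset.add_sum_erase s _ hj] at h2 ⊢
      have h3 : ∑ i ∈ s.erase j, (if i = j then ν + τ * d j else e i + τ * d i) * g i x =
          ∑ i ∈ s.erase j, e i * g i x + τ * ∑ i ∈ s.erase j, d i * g i x := by
        rw [Finset.mul_sum, ← Finset.sum_add_distrib]
        refine Finset.sum_congr rfl fun i hi => ?_
        rw [if_neg (Finset.ne_of_mem_erase hi)]
        ring
      rw [h3]
      simp only [ContinuousAffineMap.sub_apply, ContinuousAffineMap.sum_smul_apply, if_true]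
        at h1 ⊢
      linear_combination h1 - τ * h2

end Multipliers

/-! ### Support functions -/

section SupportFunction

variable {X : Type*} [AddCommGroup X] [Module ℝ X] [TopologicalSpace X]

theorem le_supportFunction {A : Set X} {x : X} (hx : x ∈ A) (xs : StrongDual ℝ X) :
    ((xs x : ℝ) : EReal) ≤ supportFunction A xs :=
  le_iSup₂ (f := fun x (_ : x ∈ A) => ((xs x : ℝ) : EReal)) x hx

theorem supportFunction_le_coe {A : Set X} {xs : StrongDual ℝ X} {r : ℝ}
    (h : ∀ x ∈ A, xs x ≤ r) : supportFunction A xs ≤ (r : EReal) :=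
  iSup₂_le fun x hx => EReal.coe_le_coe_iff.2 (h x hx)

theorem supportFunction_inter_le_add [IsTopologicalAddGroup X] (A B : Set X)
    (x₁ x₂ : StrongDual ℝ X) :
    supportFunction (A ∩ B) (x₁ + x₂) ≤ supportFunction A x₁ + supportFunction B x₂ := by
  refine iSup₂_le fun x hx => ?_
  rw [add_apply, EReal.coe_add]
  exact add_le_add (le_supportFunction hx.1 x₁) (le_supportFunction hx.2 x₂)

end SupportFunction

theorem exists_supportFunction_inter_eq_add {X : Type*} [AddCommGroup X] [Module ℝ X]
    [TopologicalSpace X] [IsTopologicalAddGroup X] [ContinuousSMul ℝ X]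
    {P Ω : Set X} (hP : IsConvexPolyhedron P) (hΩ : Convex ℝ Ω) (hq : (P ∩ qri Ω).Nonempty)
    {xs : StrongDual ℝ X} (hxs : supportFunction (P ∩ Ω) xs < ⊤) :
    ∃ x₁ x₂ : StrongDual ℝ X, xs = x₁ + x₂ ∧
      supportFunction (P ∩ Ω) xs = supportFunction P x₁ + supportFunction Ω x₂ := by
  obtain ⟨k, f, α, hP⟩ := hP
  have hmem : ∀ x, x ∈ P ↔ ∀ i, f i x ≤ α i := fun x => by rw [hP]; rfl
  obtain ⟨x₀, hx₀P, hx₀⟩ := hq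
  have hbot : supportFunction (P ∩ Ω) xs ≠ ⊥ :=
    ((EReal.bot_lt_coe _).trans_le
      (le_supportFunction (A := P ∩ Ω) ⟨hx₀P, hx₀.1⟩ xs)).ne'
  obtain ⟨β, hβ⟩ : ∃ β : ℝ, supportFunction (P ∩ Ω) xs = β :=
    ⟨_, (EReal.coe_toReal hxs.ne hbot).symm⟩
  obtain ⟨c, hc, hle⟩ := (isNonsupportPoint_of_mem_qri hx₀).exists_multipliers Finset.univ
    (fun i => (f i).toContinuousAffineMap - ContinuousAffineMap.const ℝ X (α i))
    (xs.toContinuousAffineMap - ContinuousAffineMap.const ℝ X β) hΩ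
    (fun i _ => by simpa using (hmem x₀).1 hx₀P i)
    (fun x hx hx' => by
      have h1 : x ∈ P := (hmem x).2 fun i => by simpa using hx' i (Finset.mem_univ i)
      have h2 := le_supportFunction (A := P ∩ Ω) ⟨h1, hx⟩ xs
      rw [hβ, EReal.coe_le_coe_iff] at h2
      simpa using h2)
  refine ⟨∑ i, c i • f i, xs - ∑ i, c i • f i, by abel, le_antisymm ?_ ?_⟩
  · have := supportFunction_inter_le_add P Ω (∑ i, c i • f i) (xs - ∑ i, c i • f i)
    rwa [add_sub_cancel] at this
  · have h1 : supportFunction P (∑ i, c i • f i)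
        ≤ ((∑ i, c i * α i : ℝ) : EReal) := supportFunction_le_coe fun x hx => by
      simp only [sum_apply, smul_apply, smul_eq_mul]
      exact Finset.sum_le_sum fun i _ => mul_le_mul_of_nonneg_left ((hmem x).1 hx i) (hc i)
    have h2 : supportFunction Ω (xs - ∑ i, c i • f i)
        ≤ ((β - ∑ i, c i * α i : ℝ) : EReal) := supportFunction_le_coe fun x hx => by
      have h3 := hle x hx
      simp only [ContinuousAffineMap.sub_apply, ContinuousAffineMap.coe_const, Function.const_apply,
        ContinuousLinearMap.coe_toContinuousAffineMap, mul_sub, Finset.sum_sub_distrib] at h3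
      simp only [sub_apply, sum_apply, smul_apply, smul_eq_mul]
      linarith
    rw [hβ]
    refine (add_le_add h1 h2).trans (le_of_eq ?_)
    rw [← EReal.coe_add, add_sub_cancel]

theorem theorem6p1 {X : Type*} [AddCommGroup X] [Module ℝ X] [TopologicalSpace X]
    [IsTopologicalAddGroup X] [ContinuousSMul ℝ X] [LocallyConvexSpace ℝ X]
    (P Ω : Set X) (hP : IsConvexPolyhedron P) (hΩ : Convex ℝ Ω)
    (hq : (P ∩ qri Ω).Nonempty) :
    (∀ xs : StrongDual ℝ X,
      supportFunction (P ∩ Ω) xs =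
        infimalConvolution (supportFunction P) (supportFunction Ω) xs) ∧
    (∀ xs ∈ effectiveDomain (supportFunction (P ∩ Ω)),
      ∃ x₁ x₂ : StrongDual ℝ X, xs = x₁ + x₂ ∧
        supportFunction (P ∩ Ω) xs = supportFunction P x₁ + supportFunction Ω x₂) := by
  refine ⟨fun xs => le_antisymm ?_ ?_,
    fun xs hxs => exists_supportFunction_inter_eq_add hP hΩ hq hxs⟩
  · refine le_iInf fun x₁ => le_iInf fun x₂ => le_iInf fun h => ?_
    rw [← h]
    exact supportFunction_inter_le_add P Ω x₁ x₂
  · rcases lt_or_eq_of_le (le_top (a := supportFunction (P ∩ Ω) xs)) with hlt | htop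
    · obtain ⟨x₁, x₂, h, heq⟩ := exists_supportFunction_inter_eq_add hP hΩ hq hlt
      rw [heq]
      exact iInf_le_of_le x₁ (iInf_le_of_le x₂ (iInf_le _ h.symm))
    · rw [htop]
      exact le_top
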